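/- **Theorem (Tightness analysis of Perturbed Smoothed GDA).** *Setting.* Consider $\min_{x\in\mathcal X}\max_{y\in\mathcal Y} f(x,y)$. The function $f$ is $\ell$-smooth if it is $C^1$ and $\|\nabla_x f(x,y)-\nabla_x f(x',y')\|$ and $\|\nabla_y f(x,y)-\nabla_y f(x',y')\|$ are both at most $\ell(\|x-x'\|+\|y-y'\|)$ on $\mathcal X\times\mathcal Y$. For $r_x,r_y>0$ put $$\tilde f(x,y)=f(x,y)-\tfrac{r_y}{2}\|y\|^2,\qquad \tilde F(x,y,z)=f(x,y)+\tfrac{r_x}{2}\|x-z\|^2-\tfrac{r_y}{2}\|y\|^2 .$$ Perturbed Smoothed GDA with parameters $r_x,r_y,c,\alpha,\beta$, started at $(x_0,y_0,z_0)$ with $x_0\in\mathcal X$, $y_0\in\mathcal Y$, is $$x_{t+1}=\mathrm{proj}_{\mathcal X}\big(x_t-c\nabla_x\tilde F(x_t,y_t,z_t)\big),\quad y_{t+1}=\mathrm{proj}_{\mathcal Y}\big(y_t+\alpha\nabla_y\tilde F(x_{t+1},y_t,z_t)\big),\quad z_{t+1}=z_t+\beta(x_{t+1}-z_t).$$ Its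 initial gap is $\Delta_{\Psi_2}=\Psi_2(x_0,y_0,z_0)-\min_{x\in\mathcal X}\max_{y\in\mathcal Y}\tilde f(x,y)$, where $$\Psi_2(x,y,z)=\tilde F(x,y,z)-2\min_{u\in\mathcal X}\tilde F(u,y,z)+2\min_{u\in\mathcal X}\max_{v\in\mathcal Y}\tilde F(u,v,z).$$ *Stationarity.* Let $\iota_{\mathcal S}$ be the indicator function of $\mathcal S$. A pair $(x,y)\in\mathcal X\times\mathcal Y$ is an $\epsilon$-GS if $\mathrm{dist}(0,\nabla_x f(x,y)+\partial\iota_{\mathcal X}(x))\le\epsilon$ and $\mathrm{dist}(0,-\nabla_y f(x,y)+\partial\iota_{\mathcal Y}(y))\le\epsilon$. A point $x\in\mathcal X$ is an $\epsilon$-OS if $\|\mathrm{prox}_{\frac1{2\ell}\Phi}(x)-x\|\le\frac{\epsilon}{2\ell}$, where $\Phi=\max_{y\in\mathcal Y}f(\cdot,y)+\iota_{\mathcal X}$. *Step-size conditions with $\Theta$-constant $K\ge1$.* Write $a=\Theta_K(b)$ for $b/K\le a\le Kb$. The conditions are: $r_y>0$; $r_x=\Theta_K(\ell)$ and $r_x>3\ell$;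 $c=\Theta_K(1/\ell)$ and $0<c<\frac1{r_x+\ell}$; $\alpha=\Theta_K(1/\ell)$ and $0<\alpha\le\min\big\{\frac1{11\ell},\frac{c^2(r_x-\ell)^2}{4\ell(1+c(r_x-\ell))^2}\big\}$; $\beta=\Theta_K(r_y/\ell)$ and $0<\beta\le\min\big\{\frac1{36},\frac{(r_x-\ell)^2}{384\,r_x(r_x+\ell)^2},\frac1{384\,r_x\alpha\omega^2}\big\}$, where $\omega=\frac1{\sqrt{2r_y}}\cdot\frac{(r_x-\ell)+\alpha\ell(3r_x-2\ell)}{\alpha(r_x-\ell)^{3/2}}$. *Claim.* For every $K\ge1$ there is a constant $\kappa>0$, depending only on $K$, such that the following hold for all $\ell>0$, $D_{\mathcal Y}>0$, $\epsilon>0$ and all parameters satisfying the step-size conditions. 1. (Game stationarity) If $r_y=\Theta_K(\epsilon/D_{\mathcal Y})$, then there are an $\ell$-smooth function $f$ on $\mathcal X\times\mathcal Y=\mathbb R\times[0,D_{\mathcal Y}]$, concave in $y$, for which $\min_x\max_y\tilde f$ is attained, and an initialization $(x_0,y_0,z_0)$ with $\Delta_{\Psi_2}\ge\kappa\,\epsilon^2/\ell$,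 such that some iterate $(x_T,y_T)$ of Perturbed Smoothed GDA is an $\epsilon$-GS, and whenever $(x_T,y_T)$ is an $\epsilon$-GS, then $$T\ \ge\ \kappa\,\frac{\ell^2D_{\mathcal Y}\Delta_{\Psi_2}}{\epsilon^3}.$$ 2. (Optimization stationarity) If $r_y=\Theta_K(\epsilon^2/(\ell D_{\mathcal Y}^2))$, then there are an $\ell$-smooth function $f$ on $\mathbb R\times[0,D_{\mathcal Y}]$, concave in $y$, for which $\min_x\max_y\tilde f$ is attained, and an initialization $(x_0,y_0,z_0)$ with $\Delta_{\Psi_2}\ge\kappa\,\epsilon^2/\ell$, such that some iterate $x_T$ of Perturbed Smoothed GDA is an $\epsilon$-OS, and whenever $x_T$ is an $\epsilon$-OS, then $$T\ \ge\ \kappa\,\frac{\ell^3D_{\mathcal Y}^2\Delta_{\Psi_2}}{\epsilon^4}.$$ -/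

import Mathlib

noncomputable section

/-- `a = Θ(b)` with explicit constant `K`. -/
def IsTheta (K a b : ℝ) : Prop := b / K ≤ a ∧ a ≤ K * b

section General

variable {E F : Type*}
  [NormedAddCommGroup E] [InnerProductSpace ℝ E] [CompleteSpace E]
  [NormedAddCommGroup F] [InnerProductSpace ℝ F] [CompleteSpace F]

/-- The partial gradient `∇ₓ f(x, y)`. -/
def gradX (f : E → F → ℝ) (x : E) (y : F) : E := gradient (fun u => f u y) x

/-- The partial gradient `∇_y f(x, y)`. -/
def gradY (f : E → F → ℝ) (x : E) (y : F) : F := gradient (fun v => f x v) y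

/-- `f` is continuously differentiable and `ℓ`-smooth on `X × Y`. -/
structure IsLSmooth (l : ℝ) (f : E → F → ℝ) (X : Set E) (Y : Set F) : Prop where
  contDiff : ContDiff ℝ 1 (fun p : E × F => f p.1 p.2)
  lipX : ∀ x ∈ X, ∀ x' ∈ X, ∀ y ∈ Y, ∀ y' ∈ Y,
    ‖gradX f x y - gradX f x' y'‖ ≤ l * (‖x - x'‖ + ‖y - y'‖)
  lipY : ∀ x ∈ X, ∀ x' ∈ X, ∀ y ∈ Y, ∀ y' ∈ Y,
    ‖gradY f x y - gradY f x' y'‖ ≤ l * (‖x - x'‖ + ‖y - y'‖)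

/-- `p` is the projection of `u` onto the (closed convex) set `S`. -/
def IsProj (S : Set E) (u p : E) : Prop := p ∈ S ∧ IsMinOn (fun v => ‖v - u‖) S p

/-- `p = prox_{r Φ}(u)`, where `Φ` is understood to be `+∞` outside `X`. -/
def IsProx (r : ℝ) (Φ : E → ℝ) (X : Set E) (u p : E) : Prop :=
  p ∈ X ∧ IsMinOn (fun v => Φ v + 1 / (2 * r) * ‖v - u‖ ^ 2) X p

/-- The subdifferential at `x` of the indicator function of a convex set `S`. -/
def normalCone (S : Set E) (x : E) : Set E := {v | ∀ u ∈ S, inner ℝ v (u - x) ≤ 0}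

/-- `max_{y ∈ Y} f(x, y)`. -/
def maxOver (Y : Set F) (f : E → F → ℝ) (x : E) : ℝ := sSup (f x '' Y)

/-- `min_{x ∈ X} g(x)`. -/
def minOver (X : Set E) (g : E → ℝ) : ℝ := sInf (g '' X)

/-- `x` is an `ε`-optimization-stationary point of `min_{x ∈ X} max_{y ∈ Y} f(x, y)`. -/
def IsOS (l ε : ℝ) (f : E → F → ℝ) (X : Set E) (Y : Set F) (x : E) : Prop :=
  x ∈ X ∧ ∃ p, IsProx (1 / (2 * l)) (maxOver Y f) X x p ∧ ‖p - x‖ ≤ ε / (2 * l)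

/-- `(x, y)` is an `ε`-game-stationary point of `min_{x ∈ X} max_{y ∈ Y} f(x, y)`. -/
def IsGS (ε : ℝ) (f : E → F → ℝ) (X : Set E) (Y : Set F) (x : E) (y : F) : Prop :=
  x ∈ X ∧ y ∈ Y ∧
  Metric.infDist 0 ((fun v => gradX f x y + v) '' normalCone X x) ≤ ε ∧
  Metric.infDist 0 ((fun v => -gradY f x y + v) '' normalCone Y y) ≤ ε

/-- The dually perturbed objective `f(x, y) - (r_y / 2) ‖y‖²`. -/
def perturbed (f : E → F → ℝ) (ry : ℝ) (x : E) (y : F) : ℝ :=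
  f x y - ry / 2 * ‖y‖ ^ 2

/-- The surrogate `f(x, y) + (r_x / 2) ‖x - z‖² - (r_y / 2) ‖y‖²`. -/
def surrogate (f : E → F → ℝ) (rx ry : ℝ) (z : E) (x : E) (y : F) : ℝ :=
  f x y + rx / 2 * ‖x - z‖ ^ 2 - ry / 2 * ‖y‖ ^ 2

/-- The potential function `Ψ₂`. -/
def potential (f : E → F → ℝ) (X : Set E) (Y : Set F) (rx ry : ℝ)
    (x : E) (y : F) (z : E) : ℝ :=
  surrogate f rx ry z x y
    - 2 * minOver X (fun u => surrogate f rx ry z u y)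
    + 2 * minOver X (maxOver Y (surrogate f rx ry z))

/-- The initial gap `Δ_{Ψ₂}`, as a function of the initial point. -/
def initialGap (f : E → F → ℝ) (X : Set E) (Y : Set F) (rx ry : ℝ)
    (x : E) (y : F) (z : E) : ℝ :=
  potential f X Y rx ry x y z - minOver X (maxOver Y (perturbed f ry))

end General

/-- The parameters of Perturbed Smoothed GDA. -/
structure PSGDAParams where
  rx : ℝ
  ry : ℝ
  c : ℝ
  α : ℝ
  β : ℝ

/-- The constant `ω` of the step-size condition. -/
def PSGDAParams.omega (p : PSGDAParams) (l : ℝ) : ℝ :=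
  1 / Real.sqrt (2 * p.ry) *
    (((p.rx - l) + p.α * l * (3 * p.rx - 2 * l)) / (p.α * (p.rx - l) ^ (3 / 2 : ℝ)))

/-- The step-size conditions of Perturbed Smoothed GDA; `K` is the constant in all the `Θ`'s. -/
structure PSGDAParams.StepSizeCondition (p : PSGDAParams) (K l : ℝ) : Prop where
  rx_theta : IsTheta K p.rx l
  rx_gt : 3 * l < p.rx
  ry_pos : 0 < p.ry
  α_theta : IsTheta K p.α (1 / l)
  α_pos : 0 < p.α
  α_le : p.α ≤ min (1 / (11 * l))
    (p.c ^ 2 * (p.rx - l) ^ 2 / (4 * l * (1 + p.c * (p.rx - l)) ^ 2))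
  c_theta : IsTheta K p.c (1 / l)
  c_pos : 0 < p.c
  c_lt : p.c < 1 / (p.rx + l)
  β_theta : IsTheta K p.β (p.ry / l)
  β_pos : 0 < p.β
  β_le : p.β ≤ min (1 / 36) ((p.rx - l) ^ 2 / (384 * p.rx * (p.rx + l) ^ 2))
  β_le_omega : p.β ≤ 1 / (384 * p.rx * p.α * p.omega l ^ 2)

/-- `(x t, y t, z t)` are the iterates of Perturbed Smoothed GDA on
`min_{x ∈ X} max_{y ∈ Y} f(x, y)`, started at `(x 0, y 0, z 0)`. -/
structure IsPSGDARun {E F : Type*}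
    [NormedAddCommGroup E] [InnerProductSpace ℝ E] [CompleteSpace E]
    [NormedAddCommGroup F] [InnerProductSpace ℝ F] [CompleteSpace F]
    (f : E → F → ℝ) (X : Set E) (Y : Set F) (p : PSGDAParams)
    (x : ℕ → E) (y : ℕ → F) (z : ℕ → E) : Prop where
  init_x : x 0 ∈ X
  init_y : y 0 ∈ Y
  step_x : ∀ t, IsProj X
    (x t - p.c • gradX (surrogate f p.rx p.ry (z t)) (x t) (y t)) (x (t + 1))
  step_y : ∀ t, IsProj Y
    (y t + p.α • gradY (surrogate f p.rx p.ry (z t)) (x (t + 1)) (y t)) (y (t + 1))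
  step_z : ∀ t, z (t + 1) = z t + p.β • (x (t + 1) - z t)

/-- A one-dimensional problem `min_{x ∈ ℝ} max_{y ∈ [0, D]} f(x, y)` with `f` `ℓ`-smooth, concave
in `y`, and whose perturbed value function attains its minimum. -/
structure IsInstance (l D ry : ℝ) (f : ℝ → ℝ → ℝ) : Prop where
  smooth : IsLSmooth l f Set.univ (Set.Icc 0 D)
  concave : ∀ x, ConcaveOn ℝ (Set.Icc 0 D) (f x)
  attained : ∃ x₀, IsMinOn (maxOver (Set.Icc 0 D) (perturbed f ry)) Set.univ x₀

end

/-! The hard instance is a quadratic on which the dual variable never moves. The term `ry * D * y`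
offsets the dual perturbation: on `[0, D]` the perturbed gradient in `y` is `l * x + ry * (D - y)`,
nonnegative for `x ≥ 0`. A run started at `y = D` with `x = z = R > 0` therefore keeps `y = D`,
where the coupling vanishes, and reduces to a proximal-center scheme for `(l / 2) x²`
(`isPSGDARun_coupledQuadratic`).

That scheme is slow because the center `z` loses at most a factor `1 - β` per step, while `x` stays
in the invariant cone `3z/4 ≤ x ≤ z` (`primalIterates_cone`). Stationarity forces `l * x ≤ ε` (game)
or `l * x ≤ 3ε/2` (optimization), so from `R = 4ε/l` it needs `T ≥ 1/(2β)`, which is at least of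
order `l / ry`. The initial gap is `(l / 2) R² = 8ε²/l`, and inserting the two sizes of `ry` gives
the two rates. -/

/-- A bilinearly coupled quadratic whose saddle point for every perturbed objective is `(0, D)`. -/
noncomputable def coupledQuadratic (l D ry : ℝ) (x y : ℝ) : ℝ :=
  l / 2 * x ^ 2 + l * x * (y - D) + ry * D * y

/-! ### Gradients of the instance and of its perturbations -/

lemma gradient_eq_of_hasDerivAt {g : ℝ → ℝ} {g' x : ℝ} (h : HasDerivAt g g' x) :
    gradient g x = g' := by
  rw [gradient_eq_deriv', h.deriv]

lemma gradX_coupledQuadratic (l D ry x y : ℝ) :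
    gradX (coupledQuadratic l D ry) x y = l * x + l * (y - D) := by
  apply gradient_eq_of_hasDerivAt
  unfold coupledQuadratic
  have h := ((((hasDerivAt_id x).pow 2).const_mul (l / 2)).add
    (((hasDerivAt_id x).const_mul l).mul_const (y - D))).add_const (ry * D * y)
  refine h.congr_deriv ?_
  simp
  ring

lemma gradY_coupledQuadratic (l D ry x y : ℝ) :
    gradY (coupledQuadratic l D ry) x y = l * x + ry * D := by
  apply gradient_eq_of_hasDerivAt
  unfold coupledQuadratic
  have h := ((((hasDerivAt_id y).sub_const D).const_mul (l * x)).const_add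
    (l / 2 * x ^ 2)).add ((hasDerivAt_id y).const_mul (ry * D))
  refine h.congr_deriv ?_
  simp

lemma surrogate_coupledQuadratic (l D rx ry z x y : ℝ) :
    surrogate (coupledQuadratic l D ry) rx ry z x y =
      l / 2 * x ^ 2 + l * x * (y - D) + ry * D * y + rx / 2 * (x - z) ^ 2 - ry / 2 * y ^ 2 := by
  simp only [surrogate, coupledQuadratic, Real.norm_eq_abs, sq_abs]

lemma perturbed_coupledQuadratic (l D ry x y : ℝ) :
    perturbed (coupledQuadratic l D ry) ry x y =
      l / 2 * x ^ 2 + l * x * (y - D) + ry * D * y - ry / 2 * y ^ 2 := by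
  simp only [perturbed, coupledQuadratic, Real.norm_eq_abs, sq_abs]

lemma gradX_surrogate_coupledQuadratic (l D rx ry z x y : ℝ) :
    gradX (surrogate (coupledQuadratic l D ry) rx ry z) x y =
      l * x + l * (y - D) + rx * (x - z) := by
  apply gradient_eq_of_hasDerivAt
  simp only [surrogate_coupledQuadratic]
  have h := (((((hasDerivAt_id x).pow 2).const_mul (l / 2)).add
    (((hasDerivAt_id x).const_mul l).mul_const (y - D))).add_const (ry * D * y)).add
    ((((hasDerivAt_id x).sub_const z).pow 2).const_mul (rx / 2)) |>.sub_const (ry / 2 * y ^ 2)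
  refine h.congr_deriv ?_
  simp
  ring

lemma gradY_surrogate_coupledQuadratic (l D rx ry z x y : ℝ) :
    gradY (surrogate (coupledQuadratic l D ry) rx ry z) x y = l * x + ry * (D - y) := by
  apply gradient_eq_of_hasDerivAt
  simp only [surrogate_coupledQuadratic]
  have h := (((((hasDerivAt_id y).sub_const D).const_mul (l * x)).const_add
    (l / 2 * x ^ 2)).add ((hasDerivAt_id y).const_mul (ry * D))).add_const
    (rx / 2 * (x - z) ^ 2) |>.sub (((hasDerivAt_id y).pow 2).const_mul (ry / 2))
  refine h.congr_deriv ?_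
  simp
  ring

/-! ### Saddle points and value functions -/

section Saddle

variable {E F : Type*}

lemma minOver_eq_of_isMinOn {X : Set E} {g : E → ℝ} {u : E} (hu : u ∈ X) (h : IsMinOn g X u) :
    minOver X g = g u :=
  IsLeast.csInf_eq ⟨⟨u, hu, rfl⟩, by rintro _ ⟨v, hv, rfl⟩; exact h hv⟩

lemma maxOver_eq_of_isMaxOn {Y : Set F} {h : E → F → ℝ} {u : E} {w : F} (hw : w ∈ Y)
    (hmax : IsMaxOn (h u) Y w) : maxOver Y h u = h u w :=
  IsGreatest.csSup_eq ⟨⟨w, hw, rfl⟩, by rintro _ ⟨v, hv, rfl⟩; exact hmax hv⟩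

lemma le_maxOver {Y : Set F} {h : E → F → ℝ} {u : E} {w : F} (hb : BddAbove (h u '' Y))
    (hw : w ∈ Y) : h u w ≤ maxOver Y h u :=
  le_csSup hb ⟨w, hw, rfl⟩

/-- The first component of a saddle point minimizes the max-function. -/
lemma isMinOn_maxOver_of_saddle {X : Set E} {Y : Set F} {h : E → F → ℝ} {u : E} {w : F}
    (hw : w ∈ Y) (hb : ∀ x ∈ X, BddAbove (h x '' Y))
    (hmax : IsMaxOn (h u) Y w) (hmin : IsMinOn (fun x => h x w) X u) :
    IsMinOn (maxOver Y h) X u := by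
  intro x hx
  rw [Set.mem_ofPred_eq, maxOver_eq_of_isMaxOn hw hmax]
  exact (hmin hx).trans (le_maxOver (hb x hx) hw)

end Saddle

/-! ### The instance: saddle points, initial gap, stationarity -/

section CoupledQuadratic

variable {l D rx ry : ℝ}

lemma bddAbove_coupledQuadratic (x : ℝ) :
    BddAbove (coupledQuadratic l D ry x '' Set.Icc 0 D) :=
  isCompact_Icc.bddAbove_image (by unfold coupledQuadratic; fun_prop)

lemma bddAbove_perturbed_coupledQuadratic (x : ℝ) :
    BddAbove (perturbed (coupledQuadratic l D ry) ry x '' Set.Icc 0 D) :=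
  isCompact_Icc.bddAbove_image (by unfold perturbed coupledQuadratic; fun_prop)

lemma bddAbove_surrogate_coupledQuadratic (z x : ℝ) :
    BddAbove (surrogate (coupledQuadratic l D ry) rx ry z x '' Set.Icc 0 D) :=
  isCompact_Icc.bddAbove_image (by unfold surrogate coupledQuadratic; fun_prop)

lemma isMaxOn_coupledQuadratic (hl : 0 < l) (hD : 0 < D) (hry : 0 < ry) {x : ℝ} (hx : 0 ≤ x) :
    IsMaxOn (coupledQuadratic l D ry x) (Set.Icc 0 D) D := by
  intro y hy
  simp only [Set.mem_ofPred_eq, coupledQuadratic]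
  nlinarith [mul_nonneg (add_nonneg (mul_nonneg hl.le hx) (mul_pos hry hD).le)
    (sub_nonneg.2 hy.2)]

lemma isMaxOn_perturbed_coupledQuadratic (hl : 0 < l) (hry : 0 < ry) {x : ℝ} (hx : 0 ≤ x) :
    IsMaxOn (perturbed (coupledQuadratic l D ry) ry x) (Set.Icc 0 D) D := by
  intro y hy
  simp only [Set.mem_ofPred_eq, perturbed_coupledQuadratic]
  nlinarith [mul_nonneg (mul_nonneg hl.le hx) (sub_nonneg.2 hy.2),
    mul_nonneg hry.le (sq_nonneg (D - y))]

lemma isMaxOn_surrogate_coupledQuadratic (hl : 0 < l) (hry : 0 < ry) (z : ℝ) {x : ℝ}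
    (hx : 0 ≤ x) :
    IsMaxOn (surrogate (coupledQuadratic l D ry) rx ry z x) (Set.Icc 0 D) D := by
  intro y hy
  simp only [Set.mem_ofPred_eq, surrogate_coupledQuadratic]
  nlinarith [mul_nonneg (mul_nonneg hl.le hx) (sub_nonneg.2 hy.2),
    mul_nonneg hry.le (sq_nonneg (D - y))]

lemma isMinOn_perturbed_coupledQuadratic (hl : 0 < l) :
    IsMinOn (fun x => perturbed (coupledQuadratic l D ry) ry x D) Set.univ 0 := by
  intro x _
  simp only [Set.mem_ofPred_eq, perturbed_coupledQuadratic]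
  nlinarith [mul_nonneg hl.le (sq_nonneg x)]

lemma isMinOn_surrogate_coupledQuadratic (hl : 0 < l) (hrx : 0 < rx) (z : ℝ) :
    IsMinOn (fun x => surrogate (coupledQuadratic l D ry) rx ry z x D) Set.univ
      (rx * z / (l + rx)) := by
  intro x _
  simp only [Set.mem_ofPred_eq, surrogate_coupledQuadratic]
  have hs : 0 < l + rx := by positivity
  set u := rx * z / (l + rx) with hu
  have hu' : (l + rx) * u = rx * z := by rw [hu]; field_simp
  have key : l / 2 * x ^ 2 + rx / 2 * (x - z) ^ 2 - (l / 2 * u ^ 2 + rx / 2 * (u - z) ^ 2)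
      = (l + rx) / 2 * (x - u) ^ 2 := by
    linear_combination (x - u) * hu'
  nlinarith [mul_nonneg hs.le (sq_nonneg (x - u))]

lemma isMinOn_maxOver_perturbed_coupledQuadratic (hl : 0 < l) (hD : 0 < D) (hry : 0 < ry) :
    IsMinOn (maxOver (Set.Icc 0 D) (perturbed (coupledQuadratic l D ry) ry)) Set.univ 0 :=
  isMinOn_maxOver_of_saddle (Set.right_mem_Icc.2 hD.le)
    (fun x _ => bddAbove_perturbed_coupledQuadratic x)
    (isMaxOn_perturbed_coupledQuadratic hl hry le_rfl) (isMinOn_perturbed_coupledQuadratic hl)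

lemma isInstance_coupledQuadratic (hl : 0 < l) (hD : 0 < D) (hry : 0 < ry) :
    IsInstance l D ry (coupledQuadratic l D ry) where
  smooth :=
    { contDiff := by unfold coupledQuadratic; fun_prop
      lipX := by
        intro x _ x' _ y _ y' _
        rw [gradX_coupledQuadratic, gradX_coupledQuadratic,
          show l * x + l * (y - D) - (l * x' + l * (y' - D)) = l * ((x - x') + (y - y')) by ring,
          norm_mul, Real.norm_of_nonneg hl.le]
        exact mul_le_mul_of_nonneg_left (norm_add_le _ _) hl.le
      lipY := by
        intro x _ x' _ y _ y' _
        rw [gradY_coupledQuadratic, gradY_coupledQuadratic,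
          show l * x + ry * D - (l * x' + ry * D) = l * (x - x') by ring,
          norm_mul, Real.norm_of_nonneg hl.le]
        exact mul_le_mul_of_nonneg_left (le_add_of_nonneg_right (norm_nonneg _)) hl.le }
  concave := by
    intro x
    refine ⟨convex_Icc 0 D, fun y _ y' _ a b _ _ hab => le_of_eq ?_⟩
    simp only [coupledQuadratic, smul_eq_mul]
    linear_combination (l / 2 * x ^ 2 - l * x * D) * hab
  attained := ⟨0, isMinOn_maxOver_perturbed_coupledQuadratic hl hD hry⟩

/-- The surrogate has a saddle point with `y = D`, so its min and its min-max terms in `Ψ₂` coincide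
and cancel. With `x = z` the proximal term vanishes too. -/
lemma initialGap_coupledQuadratic (hl : 0 < l) (hD : 0 < D) (hry : 0 < ry) (hrx : 0 < rx) {R : ℝ}
    (hR : 0 ≤ R) :
    initialGap (coupledQuadratic l D ry) Set.univ (Set.Icc 0 D) rx ry R D R = l / 2 * R ^ 2 := by
  have hDm : D ∈ Set.Icc 0 D := Set.right_mem_Icc.2 hD.le
  have hu : 0 ≤ rx * R / (l + rx) := by positivity
  have hmax := isMaxOn_surrogate_coupledQuadratic (D := D) (rx := rx) hl hry R hu
  have hmin := isMinOn_surrogate_coupledQuadratic (D := D) (ry := ry) hl hrx R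
  have hsad := isMinOn_maxOver_of_saddle hDm
    (fun x _ => bddAbove_surrogate_coupledQuadratic R x) hmax hmin
  rw [initialGap, potential, minOver_eq_of_isMinOn (Set.mem_univ _) hmin,
    minOver_eq_of_isMinOn (Set.mem_univ _) hsad, maxOver_eq_of_isMaxOn hDm hmax,
    minOver_eq_of_isMinOn (Set.mem_univ _)
      (isMinOn_maxOver_perturbed_coupledQuadratic hl hD hry),
    maxOver_eq_of_isMaxOn hDm (isMaxOn_perturbed_coupledQuadratic hl hry le_rfl),
    surrogate_coupledQuadratic l D rx ry R R D, perturbed_coupledQuadratic]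
  ring

lemma normalCone_univ_real (x : ℝ) : normalCone (Set.univ : Set ℝ) x = {0} := by
  ext v
  simp only [normalCone, Set.mem_univ, true_implies, Set.mem_ofPred_eq, Set.mem_singleton_iff]
  constructor
  · intro h
    have h1 := h (x + v)
    rw [add_sub_cancel_left, real_inner_self_eq_norm_sq] at h1
    exact norm_eq_zero.1 (pow_eq_zero_iff two_ne_zero |>.1 (le_antisymm h1 (sq_nonneg _)))
  · rintro rfl u
    simp

/-- The normal cone of `[0, D]` at `D` absorbs the nonnegative dual gradient, so only the primal
gradient `l * x` counts. -/
lemma isGS_coupledQuadratic_iff (hl : 0 < l) (hD : 0 < D) (hry : 0 < ry) {ε x : ℝ} (hε : 0 < ε)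
    (hx : 0 ≤ x) :
    IsGS ε (coupledQuadratic l D ry) Set.univ (Set.Icc 0 D) x D ↔ l * x ≤ ε := by
  have h1 : Metric.infDist 0 ((fun v => gradX (coupledQuadratic l D ry) x D + v) ''
      normalCone Set.univ x) = l * x := by
    rw [normalCone_univ_real, Set.image_singleton, Metric.infDist_singleton,
      gradX_coupledQuadratic, dist_zero_left, sub_self, mul_zero, add_zero, add_zero,
      Real.norm_of_nonneg (mul_nonneg hl.le hx)]
  have h2 : Metric.infDist 0 ((fun v => -gradY (coupledQuadratic l D ry) x D + v) ''
      normalCone (Set.Icc 0 D) D) = 0 := by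
    refine Metric.infDist_zero_of_mem ⟨l * x + ry * D, ?_, ?_⟩
    · intro u hu
      have hg : 0 ≤ l * x + ry * D := by positivity
      simp only [RCLike.inner_apply, conj_trivial]
      nlinarith [hu.2]
    · simp [gradY_coupledQuadratic]
  rw [IsGS, h1, h2]
  exact ⟨fun h => h.2.2.1, fun h => ⟨Set.mem_univ _, Set.right_mem_Icc.2 hD.le, h, hε.le⟩⟩

lemma maxOver_coupledQuadratic (hl : 0 < l) (hD : 0 < D) (hry : 0 < ry) {x : ℝ} (hx : 0 ≤ x) :
    maxOver (Set.Icc 0 D) (coupledQuadratic l D ry) x = l / 2 * x ^ 2 + ry * D ^ 2 := by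
  rw [maxOver_eq_of_isMaxOn (Set.right_mem_Icc.2 hD.le) (isMaxOn_coupledQuadratic hl hD hry hx),
    coupledQuadratic]
  ring

lemma le_maxOver_coupledQuadratic (hD : 0 < D) (x : ℝ) :
    l / 2 * x ^ 2 + ry * D ^ 2 ≤ maxOver (Set.Icc 0 D) (coupledQuadratic l D ry) x := by
  refine le_trans (le_of_eq ?_)
    (le_maxOver (bddAbove_coupledQuadratic x) (Set.right_mem_Icc.2 hD.le))
  rw [coupledQuadratic]
  ring

/-- The value function dominates a quadratic, with equality on `x ≥ 0`. The prox objective thus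
dominates a strongly convex quadratic and meets it at that quadratic's minimizer `2x/3`, which gives
uniqueness as well. -/
lemma isProx_coupledQuadratic_iff (hl : 0 < l) (hD : 0 < D) (hry : 0 < ry) {x : ℝ} (hx : 0 ≤ x)
    (p : ℝ) :
    IsProx (1 / (2 * l)) (maxOver (Set.Icc 0 D) (coupledQuadratic l D ry)) Set.univ x p ↔
      p = 2 / 3 * x := by
  have hc : 1 / (2 * (1 / (2 * l))) = l := by field_simp
  have h0 := maxOver_coupledQuadratic hl hD hry (x := 2 / 3 * x) (by positivity)
  simp only [IsProx, hc, Real.norm_eq_abs, sq_abs, Set.mem_univ, true_and]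
  have low : ∀ v, l / 2 * (2 / 3 * x) ^ 2 + ry * D ^ 2 + l * (2 / 3 * x - x) ^ 2
      + 3 * l / 2 * (v - 2 / 3 * x) ^ 2 ≤
      maxOver (Set.Icc 0 D) (coupledQuadratic l D ry) v + l * (v - x) ^ 2 := fun v => by
    refine le_trans (le_of_eq ?_)
      (add_le_add_left (le_maxOver_coupledQuadratic (l := l) (ry := ry) hD v) _)
    ring
  constructor
  · intro h
    have h1 := h (Set.mem_univ (2 / 3 * x))
    simp only [Set.mem_ofPred_eq, h0] at h1
    have h2 := low p
    have h3 : 3 * l / 2 * (p - 2 / 3 * x) ^ 2 ≤ 0 := by linarith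
    have h4 : (p - 2 / 3 * x) ^ 2 = 0 :=
      le_antisymm (nonpos_of_mul_nonpos_right h3 (by positivity)) (sq_nonneg _)
    exact sub_eq_zero.1 (pow_eq_zero_iff two_ne_zero |>.1 h4)
  · rintro rfl v _
    simp only [Set.mem_ofPred_eq, h0]
    have : 0 ≤ 3 * l / 2 * (v - 2 / 3 * x) ^ 2 := by positivity
    linarith [low v]

lemma isOS_coupledQuadratic_iff (hl : 0 < l) (hD : 0 < D) (hry : 0 < ry) {ε x : ℝ}
    (hx : 0 ≤ x) :
    IsOS l ε (coupledQuadratic l D ry) Set.univ (Set.Icc 0 D) x ↔ l * x ≤ 3 / 2 * ε := by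
  simp only [IsOS, isProx_coupledQuadratic_iff hl hD hry hx, exists_eq_left, Set.mem_univ,
    true_and]
  rw [show 2 / 3 * x - x = -(x / 3) by ring, norm_neg, Real.norm_of_nonneg (by positivity),
    le_div_iff₀ (by positivity)]
  constructor <;> intro h <;> linarith

end CoupledQuadratic

/-! ### The reduced primal dynamics -/

section Dynamics

variable (p : PSGDAParams) (l R : ℝ)

/-- The primal iterate `x` and the proximal center `z` of the method on `x ↦ (l / 2) x²`,
started at `x = z = R`. -/
noncomputable def primalIterates : ℕ → ℝ × ℝ
  | 0 => (R, R)
  | t + 1 =>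
    let x := (primalIterates t).1
    let z := (primalIterates t).2
    let x' := x - p.c * (l * x + p.rx * (x - z))
    (x', z + p.β * (x' - z))

lemma primalIterates_succ_fst (t : ℕ) :
    (primalIterates p l R (t + 1)).1 = (primalIterates p l R t).1 - p.c *
      (l * (primalIterates p l R t).1 +
        p.rx * ((primalIterates p l R t).1 - (primalIterates p l R t).2)) :=
  rfl

lemma primalIterates_succ_snd (t : ℕ) :
    (primalIterates p l R (t + 1)).2 = (primalIterates p l R t).2 + p.β *
      ((primalIterates p l R (t + 1)).1 - (primalIterates p l R t).2) :=
  rfl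

variable {p l R}

/-- One step of the primal dynamics, in the cone `(3 / 4) z ≤ x ≤ z`. -/
lemma primal_step_bounds {K x z x' : ℝ} (h : p.StepSizeCondition K l) (hl : 0 < l)
    (hx : 3 / 4 * z ≤ x) (hxz : x ≤ z) (hz : 0 ≤ z)
    (hx' : x' = x - p.c * (l * x + p.rx * (x - z))) :
    3 / 4 * z ≤ x' ∧ x' ≤ (1 - p.c * l) * z := by
  have hrx := h.rx_gt
  have hc := h.c_pos
  have hs : 0 < p.rx + l := by linarith
  have hlam : 0 ≤ 1 - p.c * (p.rx + l) := by
    have := (lt_div_iff₀ hs).1 h.c_lt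
    linarith
  constructor
  · have h1 := mul_nonneg hlam (sub_nonneg.2 hx)
    have h2 := mul_nonneg (mul_nonneg hc.le (by linarith : 0 ≤ p.rx - 3 * l)) hz
    rw [hx']
    linarith
  · have h1 := mul_nonneg hlam (sub_nonneg.2 hxz)
    rw [hx']
    linarith

lemma beta_le_one_div {K : ℝ} (h : p.StepSizeCondition K l) : p.β ≤ 1 / 36 :=
  h.β_le.trans (min_le_left _ _)

/-- The new center is a convex combination of `x'` and the old `z ≥ x'`, so it lies between them and
both cone inequalities survive its update. -/
lemma primalIterates_cone {K : ℝ} (h : p.StepSizeCondition K l) (hl : 0 < l) (hR : 0 ≤ R) (t : ℕ) :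
    3 / 4 * (primalIterates p l R t).2 ≤ (primalIterates p l R t).1 ∧
      (primalIterates p l R t).1 ≤ (primalIterates p l R t).2 ∧
      0 ≤ (primalIterates p l R t).2 := by
  induction t with
  | zero => exact ⟨by simp only [primalIterates]; linarith, le_rfl, hR⟩
  | succ t ih =>
    obtain ⟨h1, h2⟩ := primal_step_bounds h hl ih.1 ih.2.1 ih.2.2 (primalIterates_succ_fst p l R t)
    have hz := primalIterates_succ_snd p l R t
    generalize (primalIterates p l R (t + 1)).1 = x' at *
    generalize (primalIterates p l R t).2 = z at *
    have hβ := h.β_pos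
    have hβ1 := beta_le_one_div h
    have hcz : 0 ≤ p.c * l * z := mul_nonneg (mul_nonneg h.c_pos.le hl.le) ih.2.2
    have h3 : x' ≤ z := by linarith
    have h4 := mul_nonneg hβ.le (sub_nonneg.2 h3)
    have h5 := mul_nonneg (by linarith : 0 ≤ 1 - p.β) (sub_nonneg.2 h3)
    have h6 : 0 ≤ x' := by linarith
    rw [hz]
    exact ⟨by linarith, by linarith, by linarith⟩

/-- Since `x' ≥ 0`, averaging shrinks the center by at most `1 - β`. This is the source of the lower
bound. -/
lemma le_primalIterates_snd {K : ℝ} (h : p.StepSizeCondition K l) (hl : 0 < l) (hR : 0 ≤ R)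
    (t : ℕ) : (1 - p.β) ^ t * R ≤ (primalIterates p l R t).2 := by
  have hβ := h.β_pos
  have hβ1 := beta_le_one_div h
  induction t with
  | zero => simp [primalIterates]
  | succ t ih =>
    have h1 := mul_le_mul_of_nonneg_left ih (by linarith : 0 ≤ 1 - p.β)
    obtain ⟨hc, -, hz⟩ := primalIterates_cone h hl hR (t + 1)
    have hx : 0 ≤ p.β * (primalIterates p l R (t + 1)).1 :=
      mul_nonneg hβ.le (le_trans (by positivity) hc)
    rw [primalIterates_succ_snd, pow_succ']
    linarith

lemma contraction_factor_nonneg {K : ℝ} (h : p.StepSizeCondition K l) (hl : 0 < l) :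
    0 ≤ 1 - p.β * (p.c * l) := by
  have hβ := h.β_pos
  have hβ1 := beta_le_one_div h
  have hrx := h.rx_gt
  have hcl : p.c * l < 1 := by
    have h1 := (lt_div_iff₀ (by linarith : 0 < p.rx + l)).1 h.c_lt
    linarith [mul_pos h.c_pos (by linarith : 0 < p.rx)]
  linarith [mul_lt_mul_of_pos_left hcl hβ]

lemma primalIterates_snd_le {K : ℝ} (h : p.StepSizeCondition K l) (hl : 0 < l) (hR : 0 ≤ R)
    (t : ℕ) : (primalIterates p l R t).2 ≤ (1 - p.β * (p.c * l)) ^ t * R := by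
  have hβ := h.β_pos
  have hρ := contraction_factor_nonneg h hl
  induction t with
  | zero => simp [primalIterates]
  | succ t ih =>
    have h1 := mul_le_mul_of_nonneg_left ih hρ
    obtain ⟨hc, hxz, hz⟩ := primalIterates_cone h hl hR t
    have h2 := mul_le_mul_of_nonneg_left
      (primal_step_bounds h hl hc hxz hz (primalIterates_succ_fst p l R t)).2 hβ.le
    rw [primalIterates_succ_snd, pow_succ']
    linarith

lemma le_primalIterates_fst {K : ℝ} (h : p.StepSizeCondition K l) (hl : 0 < l) (hR : 0 ≤ R)
    (t : ℕ) : 3 / 4 * ((1 - p.β * t) * R) ≤ (primalIterates p l R t).1 := by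
  have hβ1 := beta_le_one_div h
  have hb : 1 - p.β * t ≤ (1 - p.β) ^ t := by
    -- Bernoulli's inequality.
    have := one_add_mul_le_pow (by linarith : -2 ≤ -p.β) t
    rw [← sub_eq_add_neg] at this
    linarith
  have h1 := mul_le_mul_of_nonneg_right hb hR
  linarith [le_primalIterates_snd h hl hR t, (primalIterates_cone h hl hR t).1]

lemma exists_primalIterates_fst_le {K : ℝ} (h : p.StepSizeCondition K l) (hl : 0 < l) (hR : 0 ≤ R)
    {δ : ℝ} (hδ : 0 < δ) : ∃ t, (primalIterates p l R t).1 ≤ δ := by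
  have hpos : 0 < p.β * (p.c * l) := mul_pos h.β_pos (mul_pos h.c_pos hl)
  have hρ := contraction_factor_nonneg h hl
  have hlim := (tendsto_pow_atTop_nhds_zero_of_lt_one hρ (by linarith)).mul_const R
  rw [zero_mul] at hlim
  obtain ⟨t, ht⟩ := (hlim.eventually (gt_mem_nhds hδ)).exists
  exact ⟨t, ((primalIterates_cone h hl hR t).2.1.trans (primalIterates_snd_le h hl hR t)).trans
    ht.le⟩

lemma isPSGDARun_coupledQuadratic {K D : ℝ} (h : p.StepSizeCondition K l) (hl : 0 < l)
    (hD : 0 < D) (hR : 0 ≤ R) :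
    IsPSGDARun (coupledQuadratic l D p.ry) Set.univ (Set.Icc 0 D) p
      (fun t => (primalIterates p l R t).1) (fun _ => D)
      (fun t => (primalIterates p l R t).2) where
  init_x := Set.mem_univ _
  init_y := Set.right_mem_Icc.2 hD.le
  step_x t := by
    refine ⟨Set.mem_univ _, fun v _ => ?_⟩
    rw [Set.mem_ofPred_eq, gradX_surrogate_coupledQuadratic, sub_self, mul_zero, add_zero,
      smul_eq_mul, ← primalIterates_succ_fst]
    beta_reduce
    rw [sub_self, norm_zero]
    exact norm_nonneg _
  step_y t := by
    refine ⟨Set.right_mem_Icc.2 hD.le, fun v hv => ?_⟩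
    obtain ⟨hc, -, hz⟩ := primalIterates_cone h hl hR (t + 1)
    have hx : 0 ≤ (primalIterates p l R (t + 1)).1 := le_trans (by positivity) hc
    have hstep : 0 ≤ p.α * (l * (primalIterates p l R (t + 1)).1) :=
      mul_nonneg h.α_pos.le (mul_nonneg hl.le hx)
    rw [Set.mem_ofPred_eq, gradY_surrogate_coupledQuadratic, sub_self, mul_zero, add_zero,
      smul_eq_mul]
    beta_reduce
    -- The ascent step lands at `D + α * l * x ≥ D`, so the projection returns `D`.
    rw [Real.norm_of_nonpos (by linarith), Real.norm_of_nonpos (by linarith [hv.2])]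
    linarith [hv.2]
  step_z t := primalIterates_succ_snd p l R t

/-- Reaching `l x ≤ (3 / 2) ε` from `x = z = 4 ε / l` takes at least `1 / (2 β)` steps. -/
lemma le_of_mul_primalIterates_le {K ε : ℝ} (h : p.StepSizeCondition K l) (hK : 1 ≤ K)
    (hl : 0 < l) (hε : 0 < ε) {t : ℕ}
    (ht : l * (primalIterates p l (4 * ε / l) t).1 ≤ 3 / 2 * ε) :
    l / (2 * K * p.ry) ≤ t := by
  have h1 := mul_le_mul_of_nonneg_left
    (le_primalIterates_fst h hl (by positivity : 0 ≤ 4 * ε / l) t) hl.le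
  have h2 : l * (3 / 4 * ((1 - p.β * t) * (4 * ε / l))) = 3 * (1 - p.β * t) * ε := by
    field_simp
  -- The factor `3 = (3/4) * 4` is twice the threshold `3/2`, which forces `β * t ≥ 1/2`.
  have h3 : 3 * (1 - p.β * t) ≤ 3 / 2 := le_of_mul_le_mul_right (by linarith) hε
  have h4 : p.β * t ≤ K * (p.ry / l) * t :=
    mul_le_mul_of_nonneg_right h.β_theta.2 (Nat.cast_nonneg t)
  have hry := h.ry_pos
  rw [div_le_iff₀ (by positivity)]
  have h5 : K * (p.ry / l) * t * l = K * p.ry * t := by field_simp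
  nlinarith

end Dynamics

/-! ### The two lower bounds -/

theorem mainTheorem2 :
    ∀ K : ℝ, 1 ≤ K → ∃ κ : ℝ, 0 < κ ∧
      ∀ (l D ε : ℝ), 0 < l → 0 < D → 0 < ε → ∀ p : PSGDAParams, p.StepSizeCondition K l →
        (IsTheta K p.ry (ε / D) →
          ∃ (f : ℝ → ℝ → ℝ) (x y z : ℕ → ℝ),
            IsInstance l D p.ry f ∧
            IsPSGDARun f Set.univ (Set.Icc 0 D) p x y z ∧
            κ * (ε ^ 2 / l) ≤
              initialGap f Set.univ (Set.Icc 0 D) p.rx p.ry (x 0) (y 0) (z 0) ∧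
            (∃ T : ℕ, IsGS ε f Set.univ (Set.Icc 0 D) (x T) (y T)) ∧
            ∀ T : ℕ, IsGS ε f Set.univ (Set.Icc 0 D) (x T) (y T) →
              κ * (l ^ 2 * D *
                initialGap f Set.univ (Set.Icc 0 D) p.rx p.ry (x 0) (y 0) (z 0) / ε ^ 3)
                ≤ (T : ℝ)) ∧
        (IsTheta K p.ry (ε ^ 2 / (l * D ^ 2)) →
          ∃ (f : ℝ → ℝ → ℝ) (x y z : ℕ → ℝ),
            IsInstance l D p.ry f ∧
            IsPSGDARun f Set.univ (Set.Icc 0 D) p x y z ∧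
            κ * (ε ^ 2 / l) ≤
              initialGap f Set.univ (Set.Icc 0 D) p.rx p.ry (x 0) (y 0) (z 0) ∧
            (∃ T : ℕ, IsOS l ε f Set.univ (Set.Icc 0 D) (x T)) ∧
            ∀ T : ℕ, IsOS l ε f Set.univ (Set.Icc 0 D) (x T) →
              κ * (l ^ 3 * D ^ 2 *
                initialGap f Set.univ (Set.Icc 0 D) p.rx p.ry (x 0) (y 0) (z 0) / ε ^ 4)
                ≤ (T : ℝ)) := by
  intro K hK
  -- Here `16 K² = 8 * (2K) * K`: the `8` comes from the gap `8ε²/l`, `2K` from `1/(2β) ≥ l/(2K *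
  -- ry)`, and the last `K` from the upper bound on `ry`.
  refine ⟨1 / (16 * K ^ 2), by positivity, fun l D ε hl hD hε p hp => ?_⟩
  have hR : 0 ≤ 4 * ε / l := by positivity
  have hry := hp.ry_pos
  have hrx : 0 < p.rx := by linarith [hp.rx_gt]
  have hinst := isInstance_coupledQuadratic hl hD hry
  have hrun := isPSGDARun_coupledQuadratic hp hl hD hR
  have hgap : initialGap (coupledQuadratic l D p.ry) Set.univ (Set.Icc 0 D) p.rx p.ry
      (4 * ε / l) D (4 * ε / l) = 8 * (ε ^ 2 / l) := by
    rw [initialGap_coupledQuadratic hl hD hry hrx hR]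
    field_simp
    ring
  have hκ : 1 / (16 * K ^ 2) * (ε ^ 2 / l) ≤ 8 * (ε ^ 2 / l) := by
    refine mul_le_mul_of_nonneg_right ?_ (by positivity)
    rw [div_le_iff₀ (by positivity)]
    nlinarith
  have hx : ∀ t, 0 ≤ (primalIterates p l (4 * ε / l) t).1 := fun t => by
    obtain ⟨hc, -, hz⟩ := primalIterates_cone hp hl hR t
    exact le_trans (by positivity) hc
  -- Reaching `l * x ≤ ε` settles existence for both notions, the optimization threshold `3ε/2`
  -- being weaker.
  obtain ⟨t₀, ht₀⟩ := exists_primalIterates_fst_le hp hl hR (by positivity : 0 < ε / l)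
  rw [le_div_iff₀ hl, mul_comm] at ht₀
  constructor
  · intro hθ
    refine ⟨_, _, _, _, hinst, hrun, hκ.trans_eq hgap.symm,
      ⟨t₀, (isGS_coupledQuadratic_iff hl hD hry hε (hx t₀)).2 ht₀⟩, fun T hT => ?_⟩
    have hT' := (isGS_coupledQuadratic_iff hl hD hry hε (hx T)).1 hT
    refine le_trans ?_ (le_of_mul_primalIterates_le hp hK hl hε (by linarith))
    change 1 / (16 * K ^ 2) * (l ^ 2 * D * initialGap (coupledQuadratic l D p.ry) Set.univ
      (Set.Icc 0 D) p.rx p.ry (4 * ε / l) D (4 * ε / l) / ε ^ 3) ≤ _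
    rw [hgap, show 1 / (16 * K ^ 2) * (l ^ 2 * D * (8 * (ε ^ 2 / l)) / ε ^ 3)
      = l / (2 * K * (K * (ε / D))) by field_simp; norm_num]
    have := hθ.2
    gcongr
  · intro hθ
    refine ⟨_, _, _, _, hinst, hrun, hκ.trans_eq hgap.symm,
      ⟨t₀, (isOS_coupledQuadratic_iff hl hD hry (hx t₀)).2 (by linarith)⟩, fun T hT => ?_⟩
    have hT' := (isOS_coupledQuadratic_iff hl hD hry (hx T)).1 hT
    refine le_trans ?_ (le_of_mul_primalIterates_le hp hK hl hε hT')
    change 1 / (16 * K ^ 2) * (l ^ 3 * D ^ 2 * initialGap (coupledQuadratic l D p.ry) Set.univ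
      (Set.Icc 0 D) p.rx p.ry (4 * ε / l) D (4 * ε / l) / ε ^ 4) ≤ _
    rw [hgap, show 1 / (16 * K ^ 2) * (l ^ 3 * D ^ 2 * (8 * (ε ^ 2 / l)) / ε ^ 4)
      = l / (2 * K * (K * (ε ^ 2 / (l * D ^ 2)))) by field_simp; norm_num]
    have := hθ.2
    gcongr
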